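/- Let $X$ be a complex Hilbert space. Let $A$, $B$, $C$ be closed densely defined linear operators in $X$ with $B=B^*$ and $C=C^*$, and let $$H=\begin{pmatrix} A & B\\ C & -A^*\end{pmatrix},\qquad \mathcal D(H)=(\mathcal D(A)\cap\mathcal D(C))\times(\mathcal D(B)\cap\mathcal D(A^*)),\qquad H\begin{pmatrix}x_1\\x_2\end{pmatrix}=\begin{pmatrix}Ax_1+Bx_2\\ Cx_1-A^*x_2\end{pmatrix},$$ be the associated Hamiltonian operator matrix in the Hilbert space $X\times X$, which is assumed to be densely defined. Let $$J=\begin{pmatrix}0&I\\-I&0\end{pmatrix}.$$ An operator $S$ is called $T$-bounded if $\mathcal D(T)\subset\mathcal D(S)$ and there are constants $a,b\ge 0$ with $\|Sx\|\le a\|x\|+b\|Tx\|$ for all $x\in\mathcal D(T)$; the infimum of all $b\ge0$ for which this holds with some $a\ge0$ is the relative bound of $S$ with respect to $T$. Suppose that $\mathcal D(H)=\mathcal D(C)\times\mathcal D(B)$. Then $JH=(JH)^*$, i.e. $H$ is symplectic self-adjoint, if one of the following holds: 1. $A$ is $C$-bounded with relative bound $<1$ and $A^*$ is $B$-bounded with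 relative bound $\le 1$; 2. $A$ is $C$-bounded with relative bound $\le 1$ and $A^*$ is $B$-bounded with relative bound $<1$. -/

import Mathlib

open scoped LinearPMap

noncomputable section

/-- The product `p × q` of two linear subspaces, as a subspace of the Hilbert space product
`X₁ × X₂` (Mathlib's `WithLp 2 (X₁ × X₂)`, with `⟪x, y⟫ = ⟪x.fst, y.fst⟫ + ⟪x.snd, y.snd⟫`). -/
def prodSubspace {X₁ X₂ : Type*} [AddCommGroup X₁] [Module ℂ X₁] [AddCommGroup X₂] [Module ℂ X₂]
    (p : Submodule ℂ X₁) (q : Submodule ℂ X₂) : Submodule ℂ (WithLp 2 (X₁ × X₂)) :=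
  (p.prod q).comap (WithLp.linearEquiv 2 ℂ (X₁ × X₂)).toLinearMap

/-- The block operator matrix with rows `(A, B)` and `(C, D)`, as a partially defined operator
with domain `(D(A) ∩ D(C)) × (D(B) ∩ D(D))`,
sending `(x₁, x₂)` to `(A x₁ + B x₂, C x₁ + D x₂)`. -/
def blockOperator {X₁ X₂ : Type*} [AddCommGroup X₁] [Module ℂ X₁] [AddCommGroup X₂] [Module ℂ X₂]
    (A : X₁ →ₗ.[ℂ] X₁) (B : X₂ →ₗ.[ℂ] X₁) (C : X₁ →ₗ.[ℂ] X₂) (D : X₂ →ₗ.[ℂ] X₂) :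
    WithLp 2 (X₁ × X₂) →ₗ.[ℂ] WithLp 2 (X₁ × X₂) where
  domain := prodSubspace (A.domain ⊓ C.domain) (B.domain ⊓ D.domain)
  toFun :=
    { toFun := fun x => WithLp.toLp 2
        (A ⟨x.1.fst, x.2.1.1⟩ + B ⟨x.1.snd, x.2.2.1⟩, C ⟨x.1.fst, x.2.1.2⟩ + D ⟨x.1.snd, x.2.2.2⟩)
      map_add' := fun x y => by
        have hA := A.map_add ⟨x.1.fst, x.2.1.1⟩ ⟨y.1.fst, y.2.1.1⟩
        have hB := B.map_add ⟨x.1.snd, x.2.2.1⟩ ⟨y.1.snd, y.2.2.1⟩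
        have hC := C.map_add ⟨x.1.fst, x.2.1.2⟩ ⟨y.1.fst, y.2.1.2⟩
        have hD := D.map_add ⟨x.1.snd, x.2.2.2⟩ ⟨y.1.snd, y.2.2.2⟩
        rw [← WithLp.toLp_add, Prod.mk_add_mk]
        refine congrArg (WithLp.toLp 2) (Prod.ext ?_ ?_)
        · exact (congrArg₂ (· + ·) hA hB).trans (add_add_add_comm _ _ _ _)
        · exact (congrArg₂ (· + ·) hC hD).trans (add_add_add_comm _ _ _ _)
      map_smul' := fun c x => by
        have hA := A.map_smul c ⟨x.1.fst, x.2.1.1⟩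
        have hB := B.map_smul c ⟨x.1.snd, x.2.2.1⟩
        have hC := C.map_smul c ⟨x.1.fst, x.2.1.2⟩
        have hD := D.map_smul c ⟨x.1.snd, x.2.2.2⟩
        rw [RingHom.id_apply, ← WithLp.toLp_smul, Prod.smul_mk]
        refine congrArg (WithLp.toLp 2) (Prod.ext ?_ ?_)
        · exact (congrArg₂ (· + ·) hA hB).trans (smul_add c _ _).symm
        · exact (congrArg₂ (· + ·) hC hD).trans (smul_add c _ _).symm }

/-- The unit symplectic operator matrix `J` with rows `(0, I)` and `(-I, 0)`: it sends
`(x₁, x₂)` to `(x₂, -x₁)`. -/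
def symplecticJ (X : Type*) [AddCommGroup X] [Module ℂ X] :
    WithLp 2 (X × X) →ₗ[ℂ] WithLp 2 (X × X) where
  toFun x := WithLp.toLp 2 (x.snd, -x.fst)
  map_add' x y := by
    rw [← WithLp.toLp_add, Prod.mk_add_mk]
    exact congrArg (WithLp.toLp 2) (Prod.ext rfl (neg_add x.fst y.fst))
  map_smul' c x := by
    rw [RingHom.id_apply, ← WithLp.toLp_smul, Prod.smul_mk]
    exact congrArg (WithLp.toLp 2) (Prod.ext rfl (smul_neg c x.fst).symm)

section Hamiltonian

variable {X : Type*} [NormedAddCommGroup X] [InnerProductSpace ℂ X] [CompleteSpace X]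

/-- The block operator matrix `H` with rows `(A, B)` and `(C, -A*)`. -/
def hamiltonianOperator (A B C : X →ₗ.[ℂ] X) : WithLp 2 (X × X) →ₗ.[ℂ] WithLp 2 (X × X) :=
  blockOperator A B C (-A†)

/-- The matrix with rows `(A, B)` and `(C, -A*)` is a Hamiltonian operator matrix: `A`, `B`, `C`
are closed and densely defined, `B` and `C` are self-adjoint, and `H` is densely defined. -/
structure IsHamiltonian (A B C : X →ₗ.[ℂ] X) : Prop where
  closed_A : A.IsClosed
  dense_A : Dense (A.domain : Set X)
  closed_B : B.IsClosed
  dense_B : Dense (B.domain : Set X)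
  closed_C : C.IsClosed
  dense_C : Dense (C.domain : Set X)
  selfAdjoint_B : IsSelfAdjoint B
  selfAdjoint_C : IsSelfAdjoint C
  dense_H : Dense ((hamiltonianOperator A B C).domain : Set (WithLp 2 (X × X)))

end Hamiltonian

section RelativeBound

variable {E F G : Type*} [NormedAddCommGroup E] [NormedSpace ℂ E]
  [NormedAddCommGroup F] [NormedSpace ℂ F] [NormedAddCommGroup G] [NormedSpace ℂ G]

/-- The estimate `‖S x‖ ≤ a ‖x‖ + b ‖T x‖` for all `x` in `D(T) ⊆ D(S)`, with `a, b ≥ 0`. -/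
def RelBoundedWith (S : E →ₗ.[ℂ] F) (T : E →ₗ.[ℂ] G) (a b : ℝ) : Prop :=
  0 ≤ a ∧ 0 ≤ b ∧ ∃ h : T.domain ≤ S.domain,
    ∀ x : T.domain, ‖S ⟨x, h x.2⟩‖ ≤ a * ‖(x : E)‖ + b * ‖T x‖

/-- `S` is `T`-bounded. -/
def IsRelBounded (S : E →ₗ.[ℂ] F) (T : E →ₗ.[ℂ] G) : Prop :=
  ∃ a b : ℝ, RelBoundedWith S T a b

/-- The relative bound of a `T`-bounded operator `S`: the infimum of all `b` for which the
estimate holds with some `a`. -/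
def relBound (S : E →ₗ.[ℂ] F) (T : E →ₗ.[ℂ] G) : ℝ :=
  sInf {b : ℝ | ∃ a : ℝ, RelBoundedWith S T a b}

end RelativeBound

end

/-!
Write `L = J H`, so that `L (x₁, x₂) = (C x₁ - A† x₂, -A x₁ - B x₂)` on `D(C) × D(B)`. This operator
is symmetric, and a symmetric operator is self-adjoint as soon as `L + iμ` and `L - iμ` are both
surjective for some real `μ` (`LinearPMap.isSelfAdjoint_of_surjective`).

Self-adjointness of `C` and `B` makes `C + iμ` and `-B + iμ` bijective for `μ ≠ 0`, and a relative
bound `‖S x‖ ≤ a ‖x‖ + b ‖T x‖` turns into `‖S (T + iμ)⁻¹‖ ≤ a / |μ| + b`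
(`RelBoundedWith.exists_comp_resolvent`). Substituting `u = (C + iμ) x₁` and `v = (B - iμ) x₂` in
`(L + iμ) x = f` gives the system `u - K₂ v = f₁`, `-K₁ u - v = f₂` with the bounded operators
`K₁ = A (C + iμ)⁻¹` and `K₂ = A† (B - iμ)⁻¹`. Eliminating `v` leaves
`(1 + K₂ K₁) u = f₁ - K₂ f₂`, which a Neumann series solves once `‖K₂‖ ‖K₁‖ < 1`. Only the product
of the two relative bounds enters: if one is `< 1` and the other is `≤ 1`, constants `b₁`, `b₂` with
`b₁ b₂ < 1` are admissible, and then `‖K₂‖ ‖K₁‖ < 1` for all large `|μ|`. This is why the borderline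
value `1` is allowed in one of the two conditions, where the Kato–Rellich theorem for the pair
`diag(C, -B)` and its off-diagonal perturbation would not apply directly.
-/

open scoped InnerProductSpace
open Filter Topology

/-! ### Symmetric and self-adjoint operators -/

section SelfAdjoint

variable {E : Type*} [NormedAddCommGroup E] [InnerProductSpace ℂ E]

/-- For a symmetric operator `T` and real `μ`, the two summands of `T x + iμ x` are orthogonal with
respect to the real inner product. -/
theorem LinearPMap.IsFormalAdjoint.norm_add_I_smul_sq {T : E →ₗ.[ℂ] E} (hT : T.IsFormalAdjoint T)
    (μ : ℝ) (x : T.domain) :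
    ‖T x + (Complex.I * μ) • (x : E)‖ ^ 2 = ‖T x‖ ^ 2 + μ ^ 2 * ‖(x : E)‖ ^ 2 := by
  have him : (⟪T x, (x : E)⟫_ℂ).im = 0 := by
    have h : (starRingEnd ℂ) ⟪T x, (x : E)⟫_ℂ = ⟪T x, (x : E)⟫_ℂ := by
      rw [inner_conj_symm]
      exact (hT x x).symm
    exact Complex.conj_eq_iff_im.mp h
  rw [norm_add_sq (𝕜 := ℂ), inner_smul_right, norm_smul]
  have hre : RCLike.re (Complex.I * μ * ⟪T x, (x : E)⟫_ℂ) = 0 := by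
    simp [him]
  rw [hre]
  simp [mul_pow]

variable [CompleteSpace E]

theorem IsSelfAdjoint.isFormalAdjoint {T : E →ₗ.[ℂ] E} (hT : IsSelfAdjoint T) :
    T.IsFormalAdjoint T := by
  have h := LinearPMap.adjoint_isFormalAdjoint hT.dense_domain
  rwa [LinearPMap.isSelfAdjoint_def.mp hT] at h

/-- A densely defined symmetric operator `L` for which `L + iμ` is surjective for some real `μ` and
its negative is self-adjoint. -/
theorem LinearPMap.isSelfAdjoint_of_surjective {L : E →ₗ.[ℂ] E}
    (hdense : Dense (L.domain : Set E)) (hsymm : L.IsFormalAdjoint L) (μ : ℝ)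
    (hpos : ∀ f : E, ∃ x : L.domain, L x + (Complex.I * μ) • (x : E) = f)
    (hneg : ∀ f : E, ∃ x : L.domain, L x - (Complex.I * μ) • (x : E) = f) :
    IsSelfAdjoint L := by
  have hle : L ≤ L† := LinearPMap.IsFormalAdjoint.le_adjoint hdense hsymm
  have hadj := LinearPMap.adjoint_isFormalAdjoint hdense
  rw [LinearPMap.isSelfAdjoint_def]
  refine (LinearPMap.eq_of_le_of_domain_eq hle (le_antisymm hle.1 fun y hy => ?_)).symm
  obtain ⟨x, hx⟩ := hneg (L† ⟨y, hy⟩ - (Complex.I * μ) • y)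
  -- `y - x` is orthogonal to the range of `L + iμ`, hence zero.
  have horth : ∀ w : L.domain, ⟪y - x, L w + (Complex.I * μ) • (w : E)⟫_ℂ = 0 := by
    intro w
    have h1 := hadj ⟨y, hy⟩ w
    have h2 := hsymm x w
    have h3 := congrArg (fun z => ⟪z, (w : E)⟫_ℂ) hx
    simp only [inner_sub_left, inner_smul_left, map_mul, Complex.conj_I, Complex.conj_ofReal]
      at h1 h2 h3
    simp only [inner_sub_left, inner_add_right, inner_smul_right]
    linear_combination -h1 + h2 - h3
  obtain ⟨w, hw⟩ := hpos (y - x)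
  have hzero := horth w
  rw [hw, inner_self_eq_zero, sub_eq_zero] at hzero
  rw [hzero]
  exact x.2

/-- `T + iμ` is surjective for self-adjoint `T` and real `μ ≠ 0`: its range is closed, because `T`
is closed and `T + iμ` is bounded below, and dense, because `T = T†` has no eigenvalue `iμ`. -/
theorem IsSelfAdjoint.exists_add_I_smul_eq {T : E →ₗ.[ℂ] E} (hT : IsSelfAdjoint T) {μ : ℝ}
    (hμ : μ ≠ 0) (f : E) : ∃ x : T.domain, T x + (Complex.I * μ) • (x : E) = f := by
  have hsymm := hT.isFormalAdjoint
  -- `T + iμ`, viewed as a continuous map on the graph of `T`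
  let φ : T.graph →L[ℂ] E :=
    (ContinuousLinearMap.snd ℂ E E + (Complex.I * μ : ℂ) • ContinuousLinearMap.fst ℂ E E).comp
      T.graph.subtypeL
  have hφ (x : T.domain) : φ ⟨(x, T x), T.mem_graph x⟩ = T x + (Complex.I * μ) • (x : E) := rfl
  have hgraph (g : T.graph) : ∃ x : T.domain, g = ⟨(x, T x), T.mem_graph x⟩ := by
    obtain ⟨⟨y, z⟩, hg⟩ := g
    obtain ⟨x, hx, hx'⟩ := T.mem_graph_iff.mp hg
    dsimp only at hx hx'
    subst hx hx'
    exact ⟨x, rfl⟩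
  have hcomplete : CompleteSpace T.graph :=
    IsClosed.completeSpace_coe (hs := hT.isClosed)
  have hbelow : AntilipschitzWith (Real.toNNReal (1 + |μ|⁻¹)) φ := by
    refine φ.antilipschitz_of_bound fun g => ?_
    obtain ⟨x, rfl⟩ := hgraph g
    have hsq := hsymm.norm_add_I_smul_sq μ x
    rw [hφ, Real.coe_toNNReal _ (by positivity)]
    have h1 : ‖T x‖ ≤ ‖T x + (Complex.I * μ) • (x : E)‖ :=
      abs_le_of_sq_le_sq' (by rw [hsq]; nlinarith [sq_nonneg (μ * ‖(x : E)‖)]) (norm_nonneg _) |>.2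
    have h2 : |μ| * ‖(x : E)‖ ≤ ‖T x + (Complex.I * μ) • (x : E)‖ :=
      abs_le_of_sq_le_sq' (by rw [hsq, mul_pow, sq_abs]; nlinarith [sq_nonneg ‖T x‖])
        (norm_nonneg _) |>.2
    have h3 : ‖(x : E)‖ ≤ |μ|⁻¹ * ‖T x + (Complex.I * μ) • (x : E)‖ := by
      rw [inv_mul_eq_div, le_div_iff₀ (abs_pos.mpr hμ), mul_comm]
      exact h2
    have h4 : 0 ≤ |μ|⁻¹ * ‖T x + (Complex.I * μ) • (x : E)‖ := by positivity
    rw [add_mul, one_mul]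
    exact max_le (h3.trans (le_add_of_nonneg_left (norm_nonneg _)))
      (h1.trans (le_add_of_nonneg_right h4))
  have hclosed : IsClosed (φ.range : Set E) := by
    rw [LinearMap.coe_range]
    exact hbelow.isClosed_range φ.uniformContinuous
  have hrange : φ.range = ⊤ := by
    have : CompleteSpace φ.range := IsClosed.completeSpace_coe (hs := hclosed)
    rw [← Submodule.orthogonal_eq_bot_iff, Submodule.eq_bot_iff]
    intro y hy
    have hy' (x : T.domain) : ⟪y, T x + (Complex.I * μ) • (x : E)⟫_ℂ = 0 :=
      Submodule.inner_left_of_mem_orthogonal (LinearMap.mem_range.mpr ⟨_, hφ x⟩) hy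
    have hinner (x : T.domain) : ⟪(Complex.I * μ) • y, (x : E)⟫_ℂ = ⟪y, T x⟫_ℂ := by
      have h := hy' x
      simp only [inner_add_right, inner_smul_right] at h
      simp only [inner_smul_left, map_mul, Complex.conj_I, Complex.conj_ofReal]
      linear_combination -h
    have hyd : y ∈ T†.domain := LinearPMap.mem_adjoint_domain_of_exists y ⟨_, hinner⟩
    have hyT : T† ⟨y, hyd⟩ = (Complex.I * μ) • y :=
      LinearPMap.adjoint_apply_eq hT.dense_domain _ hinner
    have hyd' : y ∈ T.domain := by
      rwa [LinearPMap.isSelfAdjoint_def.mp hT] at hyd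
    have hyT' : T ⟨y, hyd'⟩ = (Complex.I * μ) • y := by
      rw [← hyT]
      exact (LinearPMap.IsFormalAdjoint.le_adjoint hT.dense_domain hsymm).2 rfl
    -- Symmetry forces `‖T y - iμ y‖² = ‖T y‖² + μ² ‖y‖²`, while the left side vanishes.
    have hsq := hsymm.norm_add_I_smul_sq (-μ) ⟨y, hyd'⟩
    rw [hyT'] at hsq
    have h0 : (Complex.I * μ) • y + (Complex.I * ((-μ : ℝ) : ℂ)) • y = 0 := by
      rw [← add_smul]
      simp
    simp only [h0, norm_zero] at hsq
    have hpos : 0 < μ ^ 2 := by positivity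
    have : ‖y‖ ^ 2 = 0 := by
      nlinarith [sq_nonneg ‖(Complex.I * μ : ℂ) • y‖, sq_nonneg ‖y‖]
    simpa using this
  obtain ⟨g, hg⟩ : f ∈ φ.range := hrange ▸ Submodule.mem_top
  obtain ⟨x, rfl⟩ := hgraph g
  exact ⟨x, hg⟩

/-! ### Relative bounds -/

/-- If `S` is bounded relative to a self-adjoint `T` with constants `a`, `b`, then `S (T + iμ)⁻¹` is
a bounded operator of norm at most `a / |μ| + b`. The resolvent is expressed through the vector
`x = (T + iμ)⁻¹ u`. -/
theorem RelBoundedWith.exists_comp_resolvent {S T : E →ₗ.[ℂ] E} {a b : ℝ}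
    (hST : RelBoundedWith S T a b) (hT : IsSelfAdjoint T) {μ : ℝ} (hμ : μ ≠ 0) :
    ∃ K : E →L[ℂ] E, ‖K‖ ≤ a / |μ| + b ∧ ∀ u : E, ∃ (x : T.domain) (hx : (x : E) ∈ S.domain),
      T x + (Complex.I * μ) • (x : E) = u ∧ S ⟨x, hx⟩ = K u := by
  obtain ⟨ha, hb, hle, hbound⟩ := hST
  have hμ' : 0 < |μ| := abs_pos.mpr hμ
  have hsymm := hT.isFormalAdjoint
  let R : T.domain →ₗ[ℂ] E := T.toFun + (Complex.I * μ : ℂ) • T.domain.subtype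
  have hR (x : T.domain) : R x = T x + (Complex.I * μ) • (x : E) := rfl
  have hinj : Function.Injective R := by
    refine (injective_iff_map_eq_zero R).mpr fun x hx => ?_
    have hsq := hsymm.norm_add_I_smul_sq μ x
    rw [← hR, hx, norm_zero] at hsq
    have hpos : 0 < μ ^ 2 := by positivity
    have : ‖(x : E)‖ ^ 2 = 0 := by nlinarith [sq_nonneg ‖T x‖, sq_nonneg ‖(x : E)‖]
    simpa using this
  let e : T.domain ≃ₗ[ℂ] E := LinearEquiv.ofBijective R ⟨hinj, hT.exists_add_I_smul_eq hμ⟩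
  have he (u : E) : T (e.symm u) + (Complex.I * μ) • (e.symm u : E) = u := e.apply_symm_apply u
  let k : E →ₗ[ℂ] E := S.toFun ∘ₗ Submodule.inclusion hle ∘ₗ e.symm.toLinearMap
  refine ⟨k.mkContinuous (a / |μ| + b) fun u => ?_, k.mkContinuous_norm_le (by positivity) _,
    fun u => ⟨e.symm u, hle (e.symm u).2, he u, rfl⟩⟩
  have hsq := hsymm.norm_add_I_smul_sq μ (e.symm u)
  rw [he] at hsq
  have h1 : ‖T (e.symm u)‖ ≤ ‖u‖ :=
    abs_le_of_sq_le_sq' (by rw [hsq]; nlinarith [sq_nonneg (μ * ‖(e.symm u : E)‖)])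
      (norm_nonneg _) |>.2
  have h2 : |μ| * ‖(e.symm u : E)‖ ≤ ‖u‖ :=
    abs_le_of_sq_le_sq' (by rw [hsq, mul_pow, sq_abs]; nlinarith [sq_nonneg ‖T (e.symm u)‖])
      (norm_nonneg _) |>.2
  have h3 : ‖(e.symm u : E)‖ ≤ ‖u‖ / |μ| := by
    rw [le_div_iff₀ hμ', mul_comm]
    exact h2
  calc ‖k u‖ ≤ a * ‖(e.symm u : E)‖ + b * ‖T (e.symm u)‖ := hbound (e.symm u)
    _ ≤ a * (‖u‖ / |μ|) + b * ‖u‖ := by gcongr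
    _ = (a / |μ| + b) * ‖u‖ := by ring

end SelfAdjoint

theorem exists_relBoundedWith_of_relBound_lt {E F G : Type*} [NormedAddCommGroup E]
    [NormedSpace ℂ E] [NormedAddCommGroup F] [NormedSpace ℂ F] [NormedAddCommGroup G]
    [NormedSpace ℂ G] {S : E →ₗ.[ℂ] F} {T : E →ₗ.[ℂ] G} (h : IsRelBounded S T) {c : ℝ}
    (hc : relBound S T < c) : ∃ a b : ℝ, RelBoundedWith S T a b ∧ b < c := by
  obtain ⟨a₀, b₀, h₀⟩ := h
  obtain ⟨b, ⟨a, hab⟩, hb⟩ :=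
    exists_lt_of_csInf_lt (s := {b : ℝ | ∃ a : ℝ, RelBoundedWith S T a b}) ⟨b₀, a₀, h₀⟩ hc
  exact ⟨a, b, hab, hb⟩

/-- A relative bound `< 1` and a relative bound `≤ 1` leave room for constants with product
`< 1`. -/
theorem exists_relBoundedWith_mul_lt_one {E F G E' F' G' : Type*}
    [NormedAddCommGroup E] [NormedSpace ℂ E] [NormedAddCommGroup F] [NormedSpace ℂ F]
    [NormedAddCommGroup G] [NormedSpace ℂ G] [NormedAddCommGroup E'] [NormedSpace ℂ E']
    [NormedAddCommGroup F'] [NormedSpace ℂ F'] [NormedAddCommGroup G'] [NormedSpace ℂ G']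
    {S : E →ₗ.[ℂ] F} {T : E →ₗ.[ℂ] G} {S' : E' →ₗ.[ℂ] F'} {T' : E' →ₗ.[ℂ] G'}
    (h : IsRelBounded S T) (hlt : relBound S T < 1)
    (h' : IsRelBounded S' T') (hle : relBound S' T' ≤ 1) :
    ∃ a b a' b' : ℝ, RelBoundedWith S T a b ∧ RelBoundedWith S' T' a' b' ∧ b * b' < 1 := by
  obtain ⟨a, b, hab, hb⟩ := exists_relBoundedWith_of_relBound_lt h hlt
  have hb0 : 0 ≤ b := hab.2.1
  -- Any number `c > 1` with `b * c < 1` will do.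
  have hc : 1 < 2 / (1 + b) := by rw [lt_div_iff₀ (by positivity)]; linarith
  obtain ⟨a', b', hab', hb'⟩ := exists_relBoundedWith_of_relBound_lt h' (hle.trans_lt hc)
  rw [lt_div_iff₀ (by positivity)] at hb'
  exact ⟨a, b, a', b', hab, hab', by nlinarith⟩

theorem exists_pos_div_add_mul_div_add_lt_one {b b' : ℝ} (h : b * b' < 1) (a a' : ℝ) :
    ∃ μ : ℝ, 0 < μ ∧ (a / μ + b) * (a' / μ + b') < 1 := by
  have hlim (a b : ℝ) : Tendsto (fun μ : ℝ => a / μ + b) atTop (𝓝 b) := by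
    simpa using (tendsto_const_nhds.div_atTop tendsto_id).add_const b
  exact ((eventually_gt_atTop 0).and
    (((hlim a b).mul (hlim a' b')).eventually_lt_const h)).exists

/-! ### The operator `JH` -/

section Hamiltonian

variable {X : Type*} [NormedAddCommGroup X] [InnerProductSpace ℂ X] [CompleteSpace X]

theorem symplecticJ_compPMap_hamiltonianOperator_apply (A B C : X →ₗ.[ℂ] X)
    (x : ((symplecticJ X).compPMap (hamiltonianOperator A B C)).domain) :
    (symplecticJ X).compPMap (hamiltonianOperator A B C) x =
      WithLp.toLp 2 (C ⟨x.1.fst, x.2.1.2⟩ - A† ⟨x.1.snd, x.2.2.2⟩,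
        -(A ⟨x.1.fst, x.2.1.1⟩ + B ⟨x.1.snd, x.2.2.1⟩)) := by
  rw [sub_eq_add_neg]
  rfl

theorem isFormalAdjoint_symplecticJ_compPMap_hamiltonianOperator {A B C : X →ₗ.[ℂ] X}
    (hA : Dense (A.domain : Set X)) (hB : IsSelfAdjoint B) (hC : IsSelfAdjoint C) :
    ((symplecticJ X).compPMap (hamiltonianOperator A B C)).IsFormalAdjoint
      ((symplecticJ X).compPMap (hamiltonianOperator A B C)) := by
  intro x y
  have h1 := hC.isFormalAdjoint ⟨x.1.fst, x.2.1.2⟩ ⟨y.1.fst, y.2.1.2⟩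
  have h2 := hB.isFormalAdjoint ⟨x.1.snd, x.2.2.1⟩ ⟨y.1.snd, y.2.2.1⟩
  have h3 := LinearPMap.adjoint_isFormalAdjoint hA ⟨x.1.snd, x.2.2.2⟩ ⟨y.1.fst, y.2.1.1⟩
  have h4 := (LinearPMap.adjoint_isFormalAdjoint hA).symm
    ⟨x.1.fst, x.2.1.1⟩ ⟨y.1.snd, y.2.2.2⟩
  rw [symplecticJ_compPMap_hamiltonianOperator_apply,
    symplecticJ_compPMap_hamiltonianOperator_apply]
  simp only [WithLp.prod_inner_apply, inner_sub_left, inner_sub_right, inner_neg_left,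
    inner_neg_right, inner_add_left, inner_add_right]
  simp only [WithLp.ofLp_fst, WithLp.ofLp_snd] at *
  linear_combination h1 - h2 - h3 - h4

/-- `JH + iμ` is surjective when the two constants `a / |μ| + b`, which bound the norms of
`A (C + iμ)⁻¹` and `A† (B - iμ)⁻¹`, have product `< 1`. -/
theorem exists_symplecticJ_compPMap_hamiltonianOperator_add_eq {A B C : X →ₗ.[ℂ] X}
    (hB : IsSelfAdjoint B) (hC : IsSelfAdjoint C) {a b a' b' μ : ℝ}
    (hAC : RelBoundedWith A C a b) (hAB : RelBoundedWith (A†) B a' b') (hμ : μ ≠ 0)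
    (hlt : (a / |μ| + b) * (a' / |μ| + b') < 1) (f : WithLp 2 (X × X)) :
    ∃ x : ((symplecticJ X).compPMap (hamiltonianOperator A B C)).domain,
      (symplecticJ X).compPMap (hamiltonianOperator A B C) x +
        (Complex.I * μ) • (x : WithLp 2 (X × X)) = f := by
  obtain ⟨K₁, hK₁, hres₁⟩ := hAC.exists_comp_resolvent hC hμ
  obtain ⟨K₂, hK₂, hres₂⟩ := hAB.exists_comp_resolvent hB (neg_ne_zero.mpr hμ)
  rw [abs_neg] at hK₂
  have hnorm : ‖-(K₂ * K₁)‖ < 1 := by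
    rw [norm_neg]
    refine lt_of_le_of_lt ((norm_mul_le K₂ K₁).trans ?_) hlt
    rw [mul_comm]
    exact mul_le_mul hK₁ hK₂ (norm_nonneg _) ((norm_nonneg _).trans hK₁)
  -- The reduced equation `(1 + K₂ K₁) u = f₁ - K₂ f₂` is solved by a Neumann series.
  let N := Units.oneSub (-(K₂ * K₁)) hnorm
  let u : X := (↑N⁻¹ : X →L[ℂ] X) (f.fst - K₂ f.snd)
  have hu : u + K₂ (K₁ u) = f.fst - K₂ f.snd := by
    have h := congrArg (fun M : X →L[ℂ] X => M (f.fst - K₂ f.snd)) N.mul_inv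
    have hN : (N : X →L[ℂ] X) = 1 - -(K₂ * K₁) := rfl
    rw [hN, sub_neg_eq_add] at h
    exact h
  let v : X := -f.snd - K₁ u
  obtain ⟨x₁, hx₁, hux₁, hAx₁⟩ := hres₁ u
  obtain ⟨x₂, hx₂, hvx₂, hAx₂⟩ := hres₂ v
  have hmem : WithLp.toLp 2 ((x₁ : X), (x₂ : X)) ∈
      ((symplecticJ X).compPMap (hamiltonianOperator A B C)).domain := ⟨⟨hx₁, x₁.2⟩, ⟨x₂.2, hx₂⟩⟩
  refine ⟨⟨_, hmem⟩, ?_⟩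
  rw [symplecticJ_compPMap_hamiltonianOperator_apply]
  have hfst : C x₁ - A† ⟨x₂, hx₂⟩ + (Complex.I * μ) • (x₁ : X) = f.fst := by
    have hKv : K₂ v = -K₂ f.snd - K₂ (K₁ u) := by simp [v]
    rw [hAx₂, hKv, sub_add_eq_add_sub, hux₁, ← sub_add_cancel f.fst (K₂ f.snd), ← hu]
    abel
  have hsnd : -(A ⟨x₁, hx₁⟩ + B x₂) + (Complex.I * μ) • (x₂ : X) = f.snd := by
    have hv : B x₂ - (Complex.I * μ) • (x₂ : X) = -f.snd - K₁ u := by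
      rw [← show v = -f.snd - K₁ u from rfl, ← hvx₂, Complex.ofReal_neg, mul_neg, neg_smul,
        sub_eq_add_neg]
    rw [hAx₁, eq_add_of_sub_eq hv]
    abel
  exact congrArg (WithLp.toLp 2) (Prod.ext hfst hsnd)

end Hamiltonian

theorem corollary3p4 {X : Type*} [NormedAddCommGroup X] [InnerProductSpace ℂ X] [CompleteSpace X]
    (A B C : X →ₗ.[ℂ] X) (hH : IsHamiltonian A B C)
    (hdom : (hamiltonianOperator A B C).domain = prodSubspace C.domain B.domain)
    (hbound :
      ((IsRelBounded A C ∧ relBound A C < 1) ∧ (IsRelBounded (A†) B ∧ relBound (A†) B ≤ 1)) ∨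
      ((IsRelBounded A C ∧ relBound A C ≤ 1) ∧ (IsRelBounded (A†) B ∧ relBound (A†) B < 1))) :
    (symplecticJ X).compPMap (hamiltonianOperator A B C) =
      ((symplecticJ X).compPMap (hamiltonianOperator A B C))† := by
  obtain ⟨a, b, a', b', hAC, hAB, hlt⟩ : ∃ a b a' b' : ℝ,
      RelBoundedWith A C a b ∧ RelBoundedWith (A†) B a' b' ∧ b * b' < 1 := by
    rcases hbound with ⟨⟨h, hb⟩, h', hb'⟩ | ⟨⟨h, hb⟩, h', hb'⟩
    · exact exists_relBoundedWith_mul_lt_one h hb h' hb'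
    · obtain ⟨a', b', a, b, hAB, hAC, hlt⟩ := exists_relBoundedWith_mul_lt_one h' hb' h hb
      exact ⟨a, b, a', b', hAC, hAB, by rwa [mul_comm]⟩
  obtain ⟨μ, hμ, hμlt⟩ := exists_pos_div_add_mul_div_add_lt_one hlt a a'
  have hsymm := isFormalAdjoint_symplecticJ_compPMap_hamiltonianOperator hH.dense_A
    hH.selfAdjoint_B hH.selfAdjoint_C
  have hdense : Dense
      (((symplecticJ X).compPMap (hamiltonianOperator A B C)).domain : Set (WithLp 2 (X × X))) :=
    hH.dense_H
  refine (LinearPMap.isSelfAdjoint_def.mp (LinearPMap.isSelfAdjoint_of_surjective hdense hsymm μ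
    (fun f => ?_) fun f => ?_)).symm
  · exact exists_symplecticJ_compPMap_hamiltonianOperator_add_eq hH.selfAdjoint_B hH.selfAdjoint_C
      hAC hAB hμ.ne' (by rwa [abs_of_pos hμ]) f
  · obtain ⟨x, hx⟩ := exists_symplecticJ_compPMap_hamiltonianOperator_add_eq hH.selfAdjoint_B
      hH.selfAdjoint_C hAC hAB (neg_ne_zero.mpr hμ.ne') (by rwa [abs_neg, abs_of_pos hμ]) f
    exact ⟨x, by rw [← hx, Complex.ofReal_neg, mul_neg, neg_smul, sub_eq_add_neg]⟩
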